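/- Let $\mathbb X$ be a countable set with its power set as $\sigma$-algebra, and $\mathbb N=\{0,1,2,\dots\}$. Let $(\theta,\varphi)$ be a random dynamical system (RDS) on $\mathbb X$: a probability space $(\Omega,\mathcal F,\mathbb P)$, a group $(\theta_n)_{n\in\mathbb Z}$ of measure-preserving bimeasurable maps $\theta_n:\Omega\to\Omega$ (so $\theta_0=\mathrm{id}$, $\theta_{n+m}=\theta_n\circ\theta_m$) with $\theta_1$ ergodic, and a measurable map $(\omega,n,x)\mapsto\varphi^n_\omega(x)$ from $\Omega\times\mathbb N\times\mathbb X$ to $\mathbb X$ with $\varphi^0_\omega(x)=x$ and $\varphi^{n+m}_\omega(x)=\varphi^n_{\theta_m\omega}(\varphi^m_\omega(x))$ for all $\omega,n,m,x$. For integers $s<t$ let $\mathcal F_s^t$ be the $\sigma$-algebra generated by the $\mathbb P$-null sets of $\mathcal F$ and the random variables $\omega\mapsto\varphi^n_{\theta_m\omega}(x)$ with $x\in\mathbb X$, $m\in\mathbb Z$, $n\in\mathbb N$, $s\le m\le m+n\le t$; let $\mathcal F_{-\infty}^0=\sigma(\mathcal F_s^0: s<0)$ and $\mathcal F_0^\infty=\sigma(\mathcal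 F_0^t: t>0)$. Assume that the RDS is Markov, i.e. $\mathcal F_{-\infty}^0$ and $\mathcal F_0^\infty$ are independent. The RDS represents the Markov chain which, started in $x$, is given by $X_n(\omega)=\varphi^n_\omega(x)$, with transition probabilities $P(x,y)=\mathbb P(\varphi^1_\omega(x)=y)$. Write $\mathbb E_x$ for expectations of the chain started in $x$ and $\tau_x=\min\{n\ge1: X_n=x\}$ (with $\min\emptyset=\infty$). Assume that the chain is irreducible (for all $x,y$ there is $n\in\mathbb N$ with $\mathbb P(\varphi^n_\omega(x)=y)>0$) and positive recurrent ($\mathbb E_x[\tau_x]<\infty$ for all $x$), and let $\pi$ be its stationary distribution. Call $x,y\in\mathbb X$ insulated, written $x\parallel y$, if $\mathbb P(\varphi^n_\omega(x)=\varphi^n_\omega(y))=0$ for all $n\in\mathbb N$, and put $$T_\Delta(\omega,x,y)=\min\{n\in\mathbb N:\ \varphi^n_\omega(x)=\varphi^n_\omega(y)\ \text{ or }\ \varphi^n_\omega(x)\parallel\varphi^n_\omega(y)\}\in\mathbb N\cup\{\infty\}.$$ Then: (I) $\mathbb E[T_\Delta(\omega,x,y)]<\infty$ for all $x,y\in\mathbb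 X$. (II) If the chain is ergodic of degree 2, i.e. $\mathbb E_x[\tau_x^2]<\infty$ for some $x\in\mathbb X$, then $$\sum_{x,y\in\mathbb X}\pi(x)\pi(y)\,\mathbb E[T_\Delta(\omega,x,y)]<\infty.$$ -/

import Mathlib

open MeasureTheory ProbabilityTheory
open scoped ENNReal

/-- A (discrete-time, two-sided, ergodic) random dynamical system `(θ, φ)` on the countable state
space `S`, which carries its power set as σ-algebra, over the probability space `(Ω, μ)`.
`φ ω n x` is the state at time `n` of the trajectory that starts in `x`, for the noise `ω`. -/
structure RDS {Ω : Type*} [MeasurableSpace Ω] (μ : Measure Ω) [IsProbabilityMeasure μ]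
    (S : Type*) [Countable S] [MeasurableSpace S] [DiscreteMeasurableSpace S] where
  /-- the noise shifts -/
  θ : ℤ → Ω → Ω
  /-- the cocycle -/
  φ : Ω → ℕ → S → S
  θ_zero : ∀ ω, θ 0 ω = ω
  θ_add : ∀ (n m : ℤ) ω, θ (n + m) ω = θ n (θ m ω)
  θ_measurePreserving : ∀ n, MeasurePreserving (θ n) μ μ
  θ_ergodic : Ergodic (θ 1) μ
  φ_measurable : Measurable fun p : Ω × ℕ × S => φ p.1 p.2.1 p.2.2
  φ_zero : ∀ ω x, φ ω 0 x = x
  φ_add : ∀ ω (n m : ℕ) x, φ ω (n + m) x = φ (θ m ω) n (φ ω m x)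

/-- The first time `n ≥ 1` at which the path `X` is in the state `y` (`⊤` if there is none). -/
noncomputable def returnTime {S : Type*} (X : ℕ → S) (y : S) : ℕ∞ :=
  ⨅ (n : ℕ) (_ : 1 ≤ n ∧ X n = y), (n : ℕ∞)

namespace RDS

variable {Ω : Type*} [MeasurableSpace Ω] {μ : Measure Ω} [IsProbabilityMeasure μ]
  {S : Type*} [Countable S] [MeasurableSpace S] [DiscreteMeasurableSpace S]

/-- The σ-algebra `𝓕_s^t` generated by the null sets and by the random variables
`ω ↦ φ (θ m ω) n x` with `s ≤ m ≤ m + n ≤ t`. -/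
@[reducible] def sigmaBetween (R : RDS μ S) (s t : ℤ) : MeasurableSpace Ω :=
  MeasurableSpace.generateFrom {N | MeasurableSet N ∧ μ N = 0} ⊔
    ⨆ (m : ℤ) (n : ℕ) (_ : s ≤ m ∧ m + n ≤ t) (x : S),
      MeasurableSpace.comap (fun ω => R.φ (R.θ m ω) n x) inferInstance

/-- The σ-algebra `𝓕_{-∞}^t`. -/
@[reducible] def sigmaPast (R : RDS μ S) (t : ℤ) : MeasurableSpace Ω :=
  ⨆ (s : ℤ) (_ : s < t), R.sigmaBetween s t

/-- The σ-algebra `𝓕_s^∞`. -/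
@[reducible] def sigmaFuture (R : RDS μ S) (s : ℤ) : MeasurableSpace Ω :=
  ⨆ (t : ℤ) (_ : s < t), R.sigmaBetween s t

/-- An RDS is Markov if the past `𝓕_{-∞}^0` is independent of the future `𝓕_0^∞`. -/
def IsMarkov (R : RDS μ S) : Prop :=
  Indep (R.sigmaPast 0) (R.sigmaFuture 0) μ

/-- The represented chain, started in `x`: `X_n(ω) = φ ω n x`. For a Markov RDS, the law of this
process under `μ` is the law `ℙ_x` of the associated Markov chain. -/
def chain (R : RDS μ S) (x : S) (ω : Ω) : ℕ → S := fun n => R.φ ω n x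

/-- The `n`-step transition probabilities `Pⁿ(x, y) = ℙ_x(X_n = y)` of the associated chain. -/
noncomputable def transProb (R : RDS μ S) (n : ℕ) (x y : S) : ℝ≥0∞ :=
  μ {ω | R.chain x ω n = y}

/-- The associated chain is irreducible. -/
def ChainIrreducible (R : RDS μ S) : Prop :=
  ∀ x y, ∃ n, 0 < R.transProb n x y

/-- The associated chain is positive recurrent: `𝔼_x[τ_x] < ∞` for all states `x`. -/
def ChainPositiveRecurrent (R : RDS μ S) : Prop :=
  ∀ x, ∫⁻ ω, (returnTime (R.chain x ω) x : ℝ≥0∞) ∂μ < ∞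

/-- The associated chain is ergodic of degree 2: `𝔼_x[τ_x²] < ∞` for some state `x`. -/
def ChainErgodicDegreeTwo (R : RDS μ S) : Prop :=
  ∃ x, ∫⁻ ω, (returnTime (R.chain x ω) x : ℝ≥0∞) ^ 2 ∂μ < ∞

/-- `π` is a stationary distribution of the associated chain: `π P = π`. -/
def IsStationary (R : RDS μ S) (π : PMF S) : Prop :=
  ∀ y, ∑' x, π x * R.transProb 1 x y = π y

/-- `x` and `y` are insulated: almost surely, their trajectories never coincide. -/
def Insulated (R : RDS μ S) (x y : S) : Prop :=
  ∀ n : ℕ, μ {ω | R.φ ω n x = R.φ ω n y} = 0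

/-- The first time `n ≥ 0` at which the trajectories of `x` and `y` coincide or are in two insulated
states (`⊤` if there is none). -/
noncomputable def decisionTime (R : RDS μ S) (ω : Ω) (x y : S) : ℕ∞ :=
  ⨅ (n : ℕ) (_ : R.φ ω n x = R.φ ω n y ∨ R.Insulated (R.φ ω n x) (R.φ ω n y)), (n : ℕ∞)

end RDS

/-! A Foster–Lyapunov argument for the two-point motion, which is again Markov but in general not
irreducible, so its drift is built from the one-point chain. Fix `z` and let `H = R.green {z} 1` be
the expected hitting time of `z`. `exists_lyapunov` modifies `2 * H` by a bounded term into `W` with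
drift at most `-2 + 3 · 1_K` for a finite set `K`. Since `1_K(x) + 1_K(y) ≤ 1 + 1_{K×K}(x, y)`, the
sum `W x + W y` has drift at most `-4 + 3 + 3 · 1_{K×K} = -1 + 3 · 1_{K×K}`. From each pair in the
finite set `K × K`, the target (coincidence or insulation) is reached with positive probability, so
the expected number of visits to `K × K` before the target is bounded (`exists_green_finset_le`).
Hence `E[T_Δ] ≤ 2 H(x) + 2 H(y) + C`. Positive recurrence makes `H` finite, which gives (I); a
second moment of the return time makes `H` integrable under `π`, which gives (II). -/

namespace RDS

variable {Ω : Type*} [MeasurableSpace Ω] {μ : Measure Ω} [IsProbabilityMeasure μ]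
  {S : Type*} [Countable S] [MeasurableSpace S] [DiscreteMeasurableSpace S]

/-! ### Measurability with respect to past and future noise. -/

theorem measurable_φ (R : RDS μ S) (n : ℕ) (x : S) : Measurable fun ω => R.φ ω n x :=
  R.φ_measurable.comp (measurable_id.prodMk (measurable_const (a := (n, x))))

theorem measurable_comp_φ (R : RDS μ S) {β : Type*} [MeasurableSpace β] (f : S → β) (n : ℕ)
    (x : S) : Measurable fun ω => f (R.φ ω n x) :=
  (Measurable.of_discrete (f := f)).comp (R.measurable_φ n x)

theorem φ_succ (R : RDS μ S) (ω : Ω) (n : ℕ) (x : S) :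
    R.φ ω (n + 1) x = R.φ (R.θ 1 ω) n (R.φ ω 1 x) := by
  simpa using R.φ_add ω n 1 x

theorem sigmaBetween_le (R : RDS μ S) (s t : ℤ) : R.sigmaBetween s t ≤ ‹MeasurableSpace Ω› := by
  refine sup_le (MeasurableSpace.generateFrom_le fun N hN => hN.1) ?_
  refine iSup_le fun m => iSup_le fun n => iSup_le fun _ => iSup_le fun x => ?_
  exact ((R.measurable_φ n x).comp (R.θ_measurePreserving m).measurable).comap_le

theorem measurable_sigmaBetween (R : RDS μ S) {s t m : ℤ} {n : ℕ} (hs : s ≤ m) (ht : m + n ≤ t)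
    (x : S) : Measurable[R.sigmaBetween s t] fun ω => R.φ (R.θ m ω) n x := by
  refine Measurable.mono (comap_measurable _) ?_ le_rfl
  refine le_trans ?_ le_sup_right
  exact le_iSup_of_le m (le_iSup_of_le n (le_iSup_of_le ⟨hs, ht⟩ (le_iSup_of_le x le_rfl)))

theorem sigmaPast_le (R : RDS μ S) (t : ℤ) : R.sigmaPast t ≤ ‹MeasurableSpace Ω› :=
  iSup_le fun s => iSup_le fun _ => R.sigmaBetween_le s t

theorem sigmaFuture_le (R : RDS μ S) (s : ℤ) : R.sigmaFuture s ≤ ‹MeasurableSpace Ω› :=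
  iSup_le fun t => iSup_le fun _ => R.sigmaBetween_le s t

theorem measurable_sigmaFuture (R : RDS μ S) (n : ℕ) (x : S) :
    Measurable[R.sigmaFuture 0] fun ω => R.φ ω n x := by
  have h := R.measurable_sigmaBetween (s := 0) (t := n + 1) (m := 0) (n := n) le_rfl (by omega) x
  simp only [R.θ_zero] at h
  refine h.mono ?_ le_rfl
  exact le_iSup_of_le (n + 1 : ℤ) (le_iSup_of_le (by omega) le_rfl)

theorem measurable_sigmaPast (R : RDS μ S) (x : S) :
    Measurable[R.sigmaPast 0] fun ω => R.φ (R.θ (-1) ω) 1 x := by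
  refine (R.measurable_sigmaBetween (s := -1) (t := 0) (m := -1) (n := 1) le_rfl
    (by norm_num) x).mono ?_ le_rfl
  exact le_iSup_of_le (-1 : ℤ) (le_iSup_of_le (by omega) le_rfl)

/-! ### Transition operator and Markov property. -/

/-- The transition operator of the represented chain. -/
noncomputable def step (R : RDS μ S) (f : S → ℝ≥0∞) (x : S) : ℝ≥0∞ :=
  ∫⁻ ω, f (R.φ ω 1 x) ∂μ

theorem lintegral_comp_φ (R : RDS μ S) (f : S → ℝ≥0∞) (n : ℕ) (x : S) :
    ∫⁻ ω, f (R.φ ω n x) ∂μ = ∑' y, f y * R.transProb n x y := by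
  rw [← lintegral_map (f := f) (g := fun ω => R.φ ω n x) Measurable.of_discrete
    (R.measurable_φ n x), lintegral_countable']
  refine tsum_congr fun y => ?_
  rw [Measure.map_apply (R.measurable_φ n x) (measurableSet_singleton y)]
  rfl

/-- The Markov property at time one. -/
theorem IsMarkov.lintegral_shift {R : RDS μ S} (hM : R.IsMarkov) (F : S → Ω → ℝ≥0∞)
    (hF : ∀ y, Measurable[R.sigmaFuture 0] (F y)) (x : S) :
    ∫⁻ ω, F (R.φ ω 1 x) (R.θ 1 ω) ∂μ = R.step (fun y => ∫⁻ ω, F y ω ∂μ) x := by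
  have hF' : ∀ y, Measurable (F y) := fun y => (hF y).mono (R.sigmaFuture_le 0) le_rfl
  have hθ : ∀ ω, R.θ (-1) (R.θ 1 ω) = ω := fun ω => by
    rw [← R.θ_add]; simp [R.θ_zero]
  have hmeas : ∀ y : S, Measurable[R.sigmaPast 0]
      fun ω => ({y} : Set S).indicator (fun _ => (1 : ℝ≥0∞)) (R.φ (R.θ (-1) ω) 1 x) := fun y =>
    (Measurable.of_discrete (f := ({y} : Set S).indicator fun _ => (1 : ℝ≥0∞))).comp
      (R.measurable_sigmaPast x)
  -- Split over the value `y` of `X_1`. Seen from `θ 1 ω`, the first step is past noise, so each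
  -- summand is a past factor times a future factor.
  have hsum : ∀ ω, F (R.φ ω 1 x) (R.θ 1 ω) =
      ∑' y, ({y} : Set S).indicator (fun _ => (1 : ℝ≥0∞)) (R.φ (R.θ (-1) (R.θ 1 ω)) 1 x) *
        F y (R.θ 1 ω) := fun ω => by
    rw [hθ, tsum_eq_single (R.φ ω 1 x)]
    · simp
    · intro y hy
      simp [Ne.symm hy]
  have hmul : ∀ y : S, Measurable fun ω =>
      ({y} : Set S).indicator (fun _ => (1 : ℝ≥0∞)) (R.φ (R.θ (-1) ω) 1 x) * F y ω := fun y =>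
    ((hmeas y).mono (R.sigmaPast_le 0) le_rfl).mul (hF' y)
  simp only [hsum]
  have htsum := lintegral_tsum (μ := μ) fun y =>
    ((hmul y).comp (R.θ_measurePreserving 1).measurable).aemeasurable
  simp only [Function.comp_apply] at htsum
  rw [htsum, step, R.lintegral_comp_φ fun y => ∫⁻ ω, F y ω ∂μ]
  refine tsum_congr fun y => ?_
  rw [(R.θ_measurePreserving 1).lintegral_comp (hmul y),
    lintegral_mul_eq_lintegral_mul_lintegral_of_independent_measurableSpace
      (R.sigmaPast_le 0) (R.sigmaFuture_le 0) hM (hmeas y) (hF y), mul_comm]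
  congr 1
  have h1 : Measurable fun ω => ({y} : Set S).indicator (fun _ => (1 : ℝ≥0∞)) (R.φ ω 1 x) :=
    R.measurable_comp_φ _ 1 x
  rw [(R.θ_measurePreserving (-1)).lintegral_comp h1]
  have h2 : (fun ω => ({y} : Set S).indicator (fun _ => (1 : ℝ≥0∞)) (R.φ ω 1 x)) =
      {ω | R.chain x ω 1 = y}.indicator fun _ => 1 := rfl
  rw [h2, lintegral_indicator_const, one_mul, transProb]
  exact R.measurable_φ 1 x (measurableSet_singleton y)

theorem step_mono (R : RDS μ S) {f g : S → ℝ≥0∞} (h : f ≤ g) (x : S) : R.step f x ≤ R.step g x :=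
  lintegral_mono fun _ => h _

theorem step_add (R : RDS μ S) (f g : S → ℝ≥0∞) (x : S) :
    R.step (fun y => f y + g y) x = R.step f x + R.step g x :=
  lintegral_add_left (R.measurable_comp_φ f 1 x) _

theorem step_const_mul (R : RDS μ S) (c : ℝ≥0∞) (f : S → ℝ≥0∞) (x : S) :
    R.step (fun y => c * f y) x = c * R.step f x :=
  lintegral_const_mul _ (R.measurable_comp_φ f 1 x)

theorem step_const (R : RDS μ S) (c : ℝ≥0∞) (x : S) : R.step (fun _ => c) x = c := by
  simp [step]

theorem step_tsum (R : RDS μ S) {ι : Type*} [Countable ι] (f : ι → S → ℝ≥0∞) (x : S) :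
    R.step (fun y => ∑' i, f i y) x = ∑' i, R.step (f i) x :=
  lintegral_tsum fun i => (R.measurable_comp_φ (f i) 1 x).aemeasurable

theorem step_sum (R : RDS μ S) {ι : Type*} (s : Finset ι) (f : ι → S → ℝ≥0∞) (x : S) :
    R.step (fun y => ∑ i ∈ s, f i y) x = ∑ i ∈ s, R.step (f i) x :=
  lintegral_finsetSum _ fun i _ => R.measurable_comp_φ (f i) 1 x

theorem IsStationary.tsum_step {R : RDS μ S} {π : PMF S} (hπ : R.IsStationary π)
    (f : S → ℝ≥0∞) : ∑' x, π x * R.step f x = ∑' x, π x * f x := by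
  simp only [step, lintegral_comp_φ, ← ENNReal.tsum_mul_left]
  rw [ENNReal.tsum_comm]
  refine tsum_congr fun y => ?_
  rw [← hπ y, ← ENNReal.tsum_mul_right]
  exact tsum_congr fun x => by ring

/-! ### Killed chain and Green functions. -/

/-- `killed D g n x` is the expectation of `g (X_n)` on the event that `X_0, …, X_n` avoid `D`,
for the chain started in `x`. -/
noncomputable def killed (R : RDS μ S) (D : Set S) (g : S → ℝ≥0∞) : ℕ → S → ℝ≥0∞
  | 0 => Dᶜ.indicator g
  | n + 1 => Dᶜ.indicator (R.step (R.killed D g n))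

/-- The expected sum of `g` along the chain before it hits `D`. -/
noncomputable def green (R : RDS μ S) (D : Set S) (g : S → ℝ≥0∞) (x : S) : ℝ≥0∞ :=
  ∑' n, R.killed D g n x

theorem killed_of_mem (R : RDS μ S) {D : Set S} (g : S → ℝ≥0∞) (n : ℕ) {x : S} (hx : x ∈ D) :
    R.killed D g n x = 0 := by
  cases n <;> simp [killed, hx]

theorem killed_zero (R : RDS μ S) {D : Set S} (g : S → ℝ≥0∞) {x : S} (hx : x ∉ D) :
    R.killed D g 0 x = g x := by
  simp [killed, hx]

theorem killed_succ (R : RDS μ S) {D : Set S} (g : S → ℝ≥0∞) (n : ℕ) {x : S} (hx : x ∉ D) :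
    R.killed D g (n + 1) x = R.step (R.killed D g n) x := by
  simp [killed, hx]

theorem killed_tsum (R : RDS μ S) (D : Set S) {ι : Type*} [Countable ι] (g : ι → S → ℝ≥0∞)
    (n : ℕ) (x : S) :
    R.killed D (fun y => ∑' i, g i y) n x = ∑' i, R.killed D (g i) n x := by
  induction n generalizing x with
  | zero => by_cases hx : x ∈ D <;> simp [killed, hx]
  | succ n ih =>
    by_cases hx : x ∈ D
    · simp [killed, hx]
    · simp only [killed_succ R _ _ hx]
      rw [← step_tsum]
      exact congrArg (fun f => R.step f x) (funext ih)

theorem green_of_mem (R : RDS μ S) {D : Set S} (g : S → ℝ≥0∞) {x : S} (hx : x ∈ D) :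
    R.green D g x = 0 := by
  simp [green, R.killed_of_mem g _ hx]

theorem green_eq (R : RDS μ S) {D : Set S} (g : S → ℝ≥0∞) {x : S} (hx : x ∉ D) :
    R.green D g x = g x + R.step (R.green D g) x := by
  rw [green, tsum_eq_zero_add' ENNReal.summable, R.killed_zero g hx]
  simp only [R.killed_succ g _ hx]
  rw [← step_tsum]
  rfl

theorem green_tsum (R : RDS μ S) (D : Set S) {ι : Type*} [Countable ι] (g : ι → S → ℝ≥0∞)
    (x : S) : R.green D (fun y => ∑' i, g i y) x = ∑' i, R.green D (g i) x := by
  simp only [green, killed_tsum]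
  exact ENNReal.tsum_comm

/-- The Green function is the smallest nonnegative supersolution. -/
theorem green_le (R : RDS μ S) {D : Set S} {g V : S → ℝ≥0∞}
    (h : ∀ x ∉ D, g x + R.step V x ≤ V x) (x : S) : R.green D g x ≤ V x := by
  refine ENNReal.tsum_le_of_sum_range_le fun N => ?_
  induction N generalizing x with
  | zero => simp
  | succ N ih =>
    by_cases hx : x ∈ D
    · simp [R.killed_of_mem g _ hx]
    · rw [Finset.sum_range_succ', R.killed_zero g hx, add_comm]
      simp only [R.killed_succ g _ hx]
      rw [← step_sum]
      exact (add_le_add_right (R.step_mono ih x) _).trans (h x hx)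

theorem measurable_avoid {R : RDS μ S} (D : Set S) (n : ℕ) (x : S) :
    MeasurableSet[R.sigmaFuture 0] {ω | ∀ k ≤ n, R.φ ω k x ∉ D} := by
  simp only [Set.ofPred_forall]
  refine MeasurableSet.iInter fun k => MeasurableSet.iInter fun _ => ?_
  exact R.measurable_sigmaFuture k x (MeasurableSet.of_discrete (s := Dᶜ))

theorem IsMarkov.measure_shift {R : RDS μ S} (hM : R.IsMarkov) (A : S → Set Ω)
    (hA : ∀ y, MeasurableSet[R.sigmaFuture 0] (A y)) (x : S) :
    μ {ω | R.θ 1 ω ∈ A (R.φ ω 1 x)} = R.step (fun y => μ (A y)) x := by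
  have h := hM.lintegral_shift (fun y => (A y).indicator fun _ => 1)
    (fun y => measurable_const.indicator (hA y)) x
  have hA' : ∀ y, MeasurableSet (A y) := fun y => R.sigmaFuture_le 0 _ (hA y)
  simp only [lintegral_indicator_const (hA' _), one_mul] at h
  rw [← h]
  have hset : {ω | R.θ 1 ω ∈ A (R.φ ω 1 x)} =
      ⋃ y, (fun ω => R.φ ω 1 x) ⁻¹' {y} ∩ R.θ 1 ⁻¹' A y := by
    ext ω; simp
  have hmeas : MeasurableSet {ω | R.θ 1 ω ∈ A (R.φ ω 1 x)} := by
    rw [hset]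
    exact MeasurableSet.iUnion fun y => (R.measurable_φ 1 x (measurableSet_singleton y)).inter
      ((R.θ_measurePreserving 1).measurable (hA' y))
  rw [← one_mul (μ _), ← lintegral_indicator_const hmeas]
  rfl

theorem IsMarkov.killed_one {R : RDS μ S} (hM : R.IsMarkov) (D : Set S) (n : ℕ) (x : S) :
    μ {ω | ∀ k ≤ n, R.φ ω k x ∉ D} = R.killed D 1 n x := by
  induction n generalizing x with
  | zero => by_cases hx : x ∈ D <;> simp [killed, hx, R.φ_zero]
  | succ n ih =>
    by_cases hx : x ∈ D
    · rw [killed_of_mem R _ _ hx]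
      convert measure_empty (μ := μ)
      ext ω
      simp only [Set.mem_ofPred_eq, Set.mem_empty_iff_false, iff_false, not_forall]
      exact ⟨0, by omega, by simpa [R.φ_zero] using hx⟩
    · rw [killed_succ R _ _ hx, ← funext ih, ← hM.measure_shift _ (measurable_avoid D n)]
      congr 1
      ext ω
      simp only [Set.mem_ofPred_eq, ← φ_succ]
      refine ⟨fun h k hk => h (k + 1) (by omega), fun h k hk => ?_⟩
      cases k with
      | zero => simpa [R.φ_zero] using hx
      | succ k => exact h k (by omega)

/-- Time 0 is left out, so `x` may lie in `D`; with `D = {x}` this is the tail of the return time.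
-/
theorem IsMarkov.measure_avoid_succ {R : RDS μ S} (hM : R.IsMarkov) (D : Set S) (n : ℕ)
    (x : S) : μ {ω | ∀ k ≤ n, R.φ ω (k + 1) x ∉ D} = R.step (R.killed D 1 n) x := by
  rw [← funext (hM.killed_one D n), ← hM.measure_shift _ (measurable_avoid D n)]
  congr 1
  ext ω
  exact forall₂_congr fun k _ => by rw [φ_succ]

theorem IsMarkov.transProb_succ {R : RDS μ S} (hM : R.IsMarkov) (n : ℕ) (x y : S) :
    R.transProb (n + 1) x y = R.step (fun z => R.transProb n z y) x := by
  simp only [transProb, chain, R.φ_succ _ n x]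
  exact hM.measure_shift (fun z => {ω | R.φ ω n z = y})
    (fun z => R.measurable_sigmaFuture n z (measurableSet_singleton y)) x

/-- If `R.step f x` is finite, then `f (X_1)` is a.s. finite, so finiteness spreads along every path
of positive probability. -/
theorem IsMarkov.lt_top_of_step {R : RDS μ S} (hM : R.IsMarkov) (hirr : R.ChainIrreducible)
    {f : S → ℝ≥0∞} (hf : ∀ x, f x < ∞ → R.step f x < ∞) {x : S} (hx : f x < ∞) (y : S) :
    f y < ∞ := by
  obtain ⟨n, hn⟩ := hirr x y
  induction n generalizing x with
  | zero =>
    by_cases h : x = y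
    · exact h ▸ hx
    · simp [transProb, chain, R.φ_zero, h] at hn
  | succ n ih =>
    rw [hM.transProb_succ] at hn
    have h1 : ∀ᵐ ω ∂μ, f (R.φ ω 1 x) < ∞ :=
      ae_lt_top (R.measurable_comp_φ f 1 x) (hf x hx).ne
    by_contra hy
    refine hn.ne' ((lintegral_eq_zero_iff (R.measurable_comp_φ (fun z => R.transProb n z y) 1
      x)).2 ?_)
    filter_upwards [h1] with ω hω
    by_contra h
    exact hy (ih hω (pos_iff_ne_zero.2 h))

theorem IsMarkov.killed_one_le {R : RDS μ S} (hM : R.IsMarkov) (D : Set S) (n : ℕ) (x : S) :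
    R.killed D 1 n x ≤ 1 := by
  rw [← hM.killed_one]
  exact prob_le_one

theorem IsMarkov.killed_one_lt {R : RDS μ S} (hM : R.IsMarkov) {D : Set S} {n : ℕ} {x : S}
    (h : μ {ω | R.φ ω n x ∈ D} ≠ 0) : R.killed D 1 n x < 1 := by
  rw [← hM.killed_one]
  have hm : MeasurableSet {ω | R.φ ω n x ∈ D} := R.measurable_φ n x MeasurableSet.of_discrete
  calc μ {ω | ∀ k ≤ n, R.φ ω k x ∉ D} ≤ μ {ω | R.φ ω n x ∈ D}ᶜ :=
        measure_mono fun ω hω => hω n le_rfl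
    _ = 1 - μ {ω | R.φ ω n x ∈ D} := prob_compl_eq_one_sub hm
    _ < 1 := ENNReal.sub_lt_self ENNReal.one_ne_top one_ne_zero h

/-- If `D` is hit from `a` with positive probability, then the expected number of visits to `a`
before hitting `D` is bounded. -/
theorem IsMarkov.exists_green_singleton_le {R : RDS μ S} (hM : R.IsMarkov) {D : Set S} {n : ℕ}
    {a : S} (h : R.killed D 1 n a < 1) :
    ∃ C < ∞, ∀ x, R.green D (({a} : Set S).indicator 1) x ≤ C := by
  set δ := 1 - R.killed D 1 n a with hδ
  have hδ0 : δ ≠ 0 := (tsub_pos_of_lt h).ne'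
  have hδt : δ ≠ ∞ := (tsub_le_self.trans_lt ENNReal.one_lt_top).ne
  have hsum : ∀ x, ∑ j ∈ Finset.range n, R.killed D 1 j x ≤ n := fun x => by
    refine (Finset.sum_le_sum fun j _ => hM.killed_one_le D j x).trans ?_
    simp
  refine ⟨δ⁻¹ * n, ENNReal.mul_lt_top (ENNReal.inv_lt_top.2 (pos_iff_ne_zero.2 hδ0))
    (ENNReal.natCast_lt_top n), fun x => ?_⟩
  -- With `T` the hitting time of `D`, this `V` is `δ⁻¹ * E_x[min(T, n)]`. Outside `D` one step
  -- lowers it by `δ⁻¹ * P_x(T ≤ n)`, which is 1 at `a`.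
  refine (R.green_le (V := fun x => δ⁻¹ * ∑ j ∈ Finset.range n, R.killed D 1 j x)
    (fun x hx => ?_) x).trans (mul_le_mul_right (hsum x) _)
  rw [step_const_mul, step_sum]
  have hkey : (1 - R.killed D 1 n x) + ∑ j ∈ Finset.range n, R.step (R.killed D 1 j) x =
      ∑ j ∈ Finset.range n, R.killed D 1 j x := by
    have h1 := Finset.sum_range_succ (fun j => R.killed D 1 j x) n
    rw [Finset.sum_range_succ', R.killed_zero 1 hx] at h1
    simp only [R.killed_succ 1 _ hx, Pi.one_apply] at h1
    have hne : R.killed D 1 n x ≠ ∞ := ((hM.killed_one_le D n x).trans_lt ENNReal.one_lt_top).ne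
    refine (ENNReal.add_left_inj hne).1 ?_
    rw [← h1, add_right_comm, tsub_add_cancel_of_le (hM.killed_one_le D n x), add_comm]
  rw [← hkey, mul_add]
  refine add_le_add_left ?_ _
  by_cases hxa : x = a
  · subst hxa
    simp [← hδ, ENNReal.inv_mul_cancel hδ0 hδt]
  · simp [hxa]

theorem indicator_finset_eq_tsum {α : Type*} (K : Finset α) (y : α) :
    (K : Set α).indicator (1 : α → ℝ≥0∞) y = ∑' a : K, ({(a : α)} : Set α).indicator 1 y := by
  classical
  rw [Finset.tsum_subtype K fun a => ({a} : Set α).indicator (1 : α → ℝ≥0∞) y]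
  simp [Set.indicator_apply]

theorem green_finset (R : RDS μ S) (D : Set S) (K : Finset S) (x : S) :
    R.green D ((K : Set S).indicator 1) x =
      ∑ a ∈ K, R.green D (({a} : Set S).indicator 1) x := by
  rw [← Finset.tsum_subtype K fun a => R.green D (({a} : Set S).indicator 1) x, ← green_tsum]
  exact congrArg (fun f => R.green D f x) (funext (indicator_finset_eq_tsum K))

theorem green_one (R : RDS μ S) (D : Set S) (x : S) :
    R.green D 1 x = ∑' a, R.green D (({a} : Set S).indicator 1) x := by
  rw [← green_tsum]
  congr 1
  ext y
  rw [tsum_eq_single y]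
  · simp
  · intro a ha
    simp [ha.symm]

theorem IsMarkov.exists_green_finset_le {R : RDS μ S} (hM : R.IsMarkov) {D : Set S}
    (K : Finset S) (h : ∀ a ∈ K, ∃ n, R.killed D 1 n a < 1) :
    ∃ C < ∞, ∀ x, R.green D ((K : Set S).indicator 1) x ≤ C := by
  have h' : ∀ a : K, ∃ C < ∞, ∀ x, R.green D (({(a : S)} : Set S).indicator 1) x ≤ C :=
    fun a => (h a a.2).elim fun n hn => hM.exists_green_singleton_le hn
  choose C hC hle using h'
  refine ⟨∑ a : K, C a, ENNReal.sum_lt_top.2 fun a _ => hC a, fun x => ?_⟩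
  rw [green_finset, ← Finset.sum_coe_sort]
  exact Finset.sum_le_sum fun a _ => hle a x

/-! ### Two-point motion, decision times and return times. -/

/-- The two-point motion. -/
def pair (R : RDS μ S) : RDS μ (S × S) where
  θ := R.θ
  φ ω n p := (R.φ ω n p.1, R.φ ω n p.2)
  θ_zero := R.θ_zero
  θ_add := R.θ_add
  θ_measurePreserving := R.θ_measurePreserving
  θ_ergodic := R.θ_ergodic
  φ_measurable := by
    refine Measurable.prodMk ?_ ?_
    · exact R.φ_measurable.comp (f := fun p : Ω × ℕ × S × S => (p.1, p.2.1, p.2.2.1))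
        (by fun_prop)
    · exact R.φ_measurable.comp (f := fun p : Ω × ℕ × S × S => (p.1, p.2.1, p.2.2.2))
        (by fun_prop)
  φ_zero ω x := by simp [R.φ_zero]
  φ_add ω n m x := by simp [R.φ_add]

theorem pair_sigmaBetween_le (R : RDS μ S) (s t : ℤ) :
    R.pair.sigmaBetween s t ≤ R.sigmaBetween s t := by
  refine sup_le le_sup_left ?_
  refine iSup_le fun m => iSup_le fun n => iSup_le fun h => iSup_le fun p => ?_
  exact Measurable.comap_le (Measurable.prodMk (R.measurable_sigmaBetween h.1 h.2 p.1)
    (R.measurable_sigmaBetween h.1 h.2 p.2))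

/-- Both points are driven by the same noise, so the σ-algebras of the pair lie inside those of `R`.
-/
theorem IsMarkov.pair {R : RDS μ S} (hM : R.IsMarkov) : R.pair.IsMarkov :=
  indep_of_indep_of_le_left (indep_of_indep_of_le_right hM
    (iSup₂_mono fun t _ => R.pair_sigmaBetween_le 0 t))
    (iSup₂_mono fun s _ => R.pair_sigmaBetween_le s 0)

theorem pair_step_add (R : RDS μ S) (f g : S → ℝ≥0∞) (p : S × S) :
    R.pair.step (fun q => f q.1 + g q.2) p = R.step f p.1 + R.step g p.2 :=
  R.pair.step_add (fun q => f q.1) (fun q => g q.2) p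

theorem coe_lt_iInf_iff (p : ℕ → Prop) (n : ℕ) :
    (n : ℕ∞) < ⨅ (k : ℕ) (_ : p k), (k : ℕ∞) ↔ ∀ k ≤ n, ¬ p k := by
  constructor
  · intro h k hk hp
    exact absurd (h.trans_le (iInf₂_le k hp)) (by simpa using hk)
  · intro h
    refine lt_of_lt_of_le (b := ((n + 1 : ℕ) : ℕ∞)) (by exact_mod_cast n.lt_succ_self)
      (le_iInf₂ fun k hp => ?_)
    have : n < k := by
      by_contra hk
      exact h k (by omega) hp
    exact_mod_cast this

theorem tsum_coe_lt (t : ℕ∞) :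
    ∑' n : ℕ, {m : ℕ | (m : ℕ∞) < t}.indicator (1 : ℕ → ℝ≥0∞) n = t := by
  induction t using ENat.recTopCoe with
  | top => simp
  | coe m =>
    rw [tsum_eq_sum (s := Finset.range m)]
    · simp only [Set.indicator_apply, Set.mem_ofPred_eq, Nat.cast_lt, Pi.one_apply]
      rw [Finset.sum_congr rfl fun n hn => if_pos (Finset.mem_range.1 hn)]
      simp
    · intro n hn
      simpa using hn

theorem tsum_mul_coe_lt_le (t : ℕ∞) :
    ∑' n : ℕ, (n : ℝ≥0∞) * {m : ℕ | (m : ℕ∞) < t}.indicator (1 : ℕ → ℝ≥0∞) n ≤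
      (t : ℝ≥0∞) ^ 2 := by
  rw [sq]
  conv_rhs => rhs; rw [← tsum_coe_lt t]
  rw [← ENNReal.tsum_mul_left]
  refine ENNReal.tsum_le_tsum fun n => ?_
  by_cases h : (n : ℕ∞) < t
  · exact mul_le_mul_left (by exact_mod_cast ENat.toENNReal_le.2 h.le) _
  · simp [h]

/-- Tail-sum formula: `T_Δ > n` means that the pair avoids the target up to time `n`. -/
theorem IsMarkov.lintegral_decisionTime {R : RDS μ S} (hM : R.IsMarkov) (x y : S) :
    ∫⁻ ω, (R.decisionTime ω x y : ℝ≥0∞) ∂μ =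
      R.pair.green {p | p.1 = p.2 ∨ R.Insulated p.1 p.2} 1 (x, y) := by
  set D : Set (S × S) := {p | p.1 = p.2 ∨ R.Insulated p.1 p.2} with hD
  have hset : ∀ n : ℕ, {ω | (n : ℕ∞) < R.decisionTime ω x y} =
      {ω | ∀ k ≤ n, R.pair.φ ω k (x, y) ∉ D} := fun n => by
    ext ω
    simp only [Set.mem_ofPred_eq, decisionTime]
    rw [coe_lt_iInf_iff fun k => R.φ ω k x = R.φ ω k y ∨ R.Insulated (R.φ ω k x) (R.φ ω k y)]
    rfl
  have hmeas : ∀ n : ℕ, MeasurableSet {ω | (n : ℕ∞) < R.decisionTime ω x y} := fun n => by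
    rw [hset]
    exact R.pair.sigmaFuture_le 0 _ (measurable_avoid D n (x, y))
  have hrew : ∀ ω, (R.decisionTime ω x y : ℝ≥0∞) =
      ∑' n : ℕ, {ω | (n : ℕ∞) < R.decisionTime ω x y}.indicator 1 ω := fun ω => by
    rw [← tsum_coe_lt (R.decisionTime ω x y)]
    rfl
  simp only [hrew]
  rw [lintegral_tsum fun n => (measurable_one.indicator (hmeas n)).aemeasurable]
  refine tsum_congr fun n => ?_
  rw [lintegral_indicator_one (hmeas n), hset, hM.pair.killed_one]

theorem coe_lt_returnTime_iff (R : RDS μ S) (n : ℕ) (ω : Ω) (x : S) :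
    ((n + 1 : ℕ) : ℕ∞) < returnTime (R.chain x ω) x ↔
      ∀ k ≤ n, R.φ ω (k + 1) x ∉ ({x} : Set S) := by
  rw [returnTime, coe_lt_iInf_iff fun k => 1 ≤ k ∧ R.chain x ω k = x]
  refine ⟨fun h k hk hx => h (k + 1) (by omega) ⟨by omega, hx⟩, fun h k hk hx => ?_⟩
  obtain ⟨k, rfl⟩ := Nat.exists_eq_add_of_le' hx.1
  exact h k (by omega) hx.2

/-- The factor of `c (n + 1)` is `P_x(τ_x > n + 1)`; the inequality comes from dropping the term of
time 0. Used with `c = 1` for the first moment of `τ_x` and `c n = n` for the second. -/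
theorem IsMarkov.tsum_mul_step_killed_le {R : RDS μ S} (hM : R.IsMarkov) (c : ℕ → ℝ≥0∞)
    (x : S) :
    ∑' n, c (n + 1) * R.step (R.killed {x} 1 n) x ≤
      ∫⁻ ω, ∑' n : ℕ, c n *
        {m : ℕ | (m : ℕ∞) < returnTime (R.chain x ω) x}.indicator (1 : ℕ → ℝ≥0∞) n ∂μ := by
  have hmeas : ∀ n, MeasurableSet {ω | ∀ k ≤ n, R.φ ω (k + 1) x ∉ ({x} : Set S)} := fun n => by
    simp only [Set.ofPred_forall]
    exact MeasurableSet.iInter fun k => MeasurableSet.iInter fun _ =>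
      R.measurable_φ (k + 1) x (measurableSet_singleton x).compl
  calc ∑' n, c (n + 1) * R.step (R.killed {x} 1 n) x
      = ∑' n, ∫⁻ ω, c (n + 1) *
          {ω | ∀ k ≤ n, R.φ ω (k + 1) x ∉ ({x} : Set S)}.indicator 1 ω ∂μ := by
        refine tsum_congr fun n => ?_
        rw [lintegral_const_mul _ (measurable_one.indicator (hmeas n)),
          lintegral_indicator_one (hmeas n), hM.measure_avoid_succ]
    _ = ∫⁻ ω, ∑' n, c (n + 1) *
          {ω | ∀ k ≤ n, R.φ ω (k + 1) x ∉ ({x} : Set S)}.indicator 1 ω ∂μ :=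
        (lintegral_tsum fun n =>
          ((measurable_one.indicator (hmeas n)).const_mul _).aemeasurable).symm
    _ ≤ _ := by
        refine lintegral_mono fun ω => ?_
        simp only []
        rw [tsum_eq_zero_add' (f := fun n : ℕ => c n * _) ENNReal.summable]
        refine le_add_left (ENNReal.tsum_le_tsum fun n => le_of_eq ?_)
        congr 1
        have h := R.coe_lt_returnTime_iff n ω x
        by_cases hn : ((n + 1 : ℕ) : ℕ∞) < returnTime (R.chain x ω) x
        · rw [Set.indicator_of_mem (by exact h.1 hn), Set.indicator_of_mem (by exact hn)]
          rfl
        · rw [Set.indicator_of_notMem (by exact fun hk => hn (h.2 hk)),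
            Set.indicator_of_notMem (by exact hn)]

theorem IsMarkov.step_green_one_lt_top {R : RDS μ S} (hM : R.IsMarkov)
    (hpos : R.ChainPositiveRecurrent) (x : S) : R.step (R.green {x} 1) x < ∞ := by
  refine lt_of_le_of_lt ?_ (hpos x)
  have h := hM.tsum_mul_step_killed_le (fun _ => 1) x
  simp only [one_mul, tsum_coe_lt] at h
  exact (R.step_tsum _ x).trans_le h

theorem IsMarkov.green_one_lt_top {R : RDS μ S} (hM : R.IsMarkov) (hirr : R.ChainIrreducible)
    (hpos : R.ChainPositiveRecurrent) (z x : S) : R.green {z} 1 x < ∞ := by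
  refine hM.lt_top_of_step hirr (fun x hx => ?_) (x := z) (by simp [R.green_of_mem]) x
  by_cases hxz : x = z
  · exact hxz ▸ hM.step_green_one_lt_top hpos z
  · rw [R.green_eq (D := {z}) 1 hxz] at hx
    exact lt_of_le_of_lt le_add_self hx

/-! ### Lyapunov function and bound on the decision time. -/

/-- A Foster–Lyapunov function whose drift is so small on a finite set `K` that
the sum of two copies still has negative drift outside `K ×ˢ K`. -/
theorem IsMarkov.exists_lyapunov {R : RDS μ S} (hM : R.IsMarkov) (hirr : R.ChainIrreducible)
    (hpos : R.ChainPositiveRecurrent) (z : S) :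
    ∃ (K : Finset S) (W : S → ℝ≥0∞) (C : ℝ≥0∞), C < ∞ ∧
      (∀ x, W x ≤ 2 * R.green {z} 1 x + C) ∧
      ∀ x, R.step W x + 2 ≤ W x + 3 * (K : Set S).indicator 1 x := by
  set H := R.green {z} 1 with hH
  -- `N a` is the expected number of visits to `a` in one excursion from `z`, time 0 included and
  -- the return excluded; the total is `E_z[τ_z]`.
  set N : S → ℝ≥0∞ := fun a =>
    ({a} : Set S).indicator 1 z + R.step (R.green {z} (({a} : Set S).indicator 1)) z with hN
  have hNsum : ∑' a, N a = 1 + R.step H z := by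
    rw [hN, ENNReal.tsum_add, ← step_tsum]
    congr 1
    · rw [tsum_eq_single z] <;> simp +contextual [eq_comm]
    · congr 1
      ext y
      exact (R.green_one {z} y).symm
  have hNfin : ∑' a, N a ≠ ∞ := by
    rw [hNsum]
    exact ENNReal.add_ne_top.2 ⟨ENNReal.one_ne_top, (hM.step_green_one_lt_top hpos z).ne⟩
  have hNpos : ∑' a, N a ≠ 0 := by
    rw [hNsum]; simp
  -- `K` carries at least two thirds of the time of an excursion. This is the drift inequality
  -- needed at `z`.
  obtain ⟨K, hK⟩ : ∃ K : Finset S, 2 * ∑' a, N a ≤ 3 * ∑ a ∈ K, N a := by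
    have hlt : 2 * ∑' a, N a < ⨆ K : Finset S, 3 * ∑ a ∈ K, N a := by
      rw [← ENNReal.mul_iSup, ← ENNReal.tsum_eq_iSup_sum]
      exact (ENNReal.mul_lt_mul_iff_left hNpos hNfin).2 (by norm_num)
    obtain ⟨K, hK⟩ := lt_iSup_iff.1 hlt
    exact ⟨K, hK.le⟩
  obtain ⟨M, hM', hG⟩ := hM.exists_green_finset_le (D := {z}) K fun a _ => by
    obtain ⟨n, hn⟩ := hirr a z
    exact ⟨n, hM.killed_one_lt hn.ne'⟩
  set G := R.green {z} ((K : Set S).indicator 1) with hGdef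
  have hNK : ∑ a ∈ K, N a = (K : Set S).indicator 1 z + R.step G z := by
    rw [hN, Finset.sum_add_distrib, ← step_sum]
    congr 1
    · rw [indicator_finset_eq_tsum,
        Finset.tsum_subtype K fun a => ({a} : Set S).indicator (1 : S → ℝ≥0∞) z]
    · congr 1
      ext y
      exact (R.green_finset {z} K y).symm
  have hU : ∀ x, R.step (fun y => M - G y) x + R.step G x = M := fun x => by
    rw [← step_add]
    simp only [tsub_add_cancel_of_le (hG _), step_const]
  have hstepG : ∀ x, R.step G x ≠ ∞ := fun x =>
    ((le_add_self.trans_eq (hU x)).trans_lt hM').ne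
  -- As `G ≤ M`, the truncated subtraction is exact. Off `z`, one step lowers `H` by 1 and raises `M
  -- - G` by `1_K`, so the drift is exactly `-2 + 3 · 1_K`.
  refine ⟨K, fun x => 2 * H x + 3 * (M - G x), 3 * M,
    ENNReal.mul_lt_top (by norm_num) hM', fun x => ?_, fun x => ?_⟩
  · simp only []
    gcongr
    exact tsub_le_self
  · simp only []
    rw [step_add, step_const_mul, step_const_mul]
    by_cases hxz : x = z
    · subst hxz
      have hH0 : H x = 0 := R.green_of_mem 1 rfl
      have hG0 : G x = 0 := R.green_of_mem _ rfl
      rw [hH0, hG0, tsub_zero, mul_zero, zero_add]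
      rw [hNsum, hNK] at hK
      calc _ = 2 * (1 + R.step H x) + 3 * R.step (fun y => M - G y) x := by ring
        _ ≤ 3 * ((K : Set S).indicator 1 x + R.step G x) +
            3 * R.step (fun y => M - G y) x := by gcongr
        _ = 3 * (R.step (fun y => M - G y) x + R.step G x) +
            3 * (K : Set S).indicator 1 x := by ring
        _ = _ := by rw [hU]
    · have hHx : H x = 1 + R.step H x := R.green_eq 1 hxz
      have hGx : G x = (K : Set S).indicator 1 x + R.step G x := R.green_eq _ hxz
      have hUx : R.step (fun y => M - G y) x = M - G x + (K : Set S).indicator 1 x := by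
        refine (ENNReal.add_left_inj (hstepG x)).1 ?_
        rw [hU, add_assoc, ← hGx, tsub_add_cancel_of_le (hG x)]
      rw [hUx, hHx]
      exact le_of_eq (by ring)

theorem IsMarkov.exists_lintegral_decisionTime_le {R : RDS μ S} (hM : R.IsMarkov)
    (hirr : R.ChainIrreducible) (hpos : R.ChainPositiveRecurrent) (z : S) :
    ∃ C < ∞, ∀ x y, ∫⁻ ω, (R.decisionTime ω x y : ℝ≥0∞) ∂μ ≤
      2 * R.green {z} 1 x + 2 * R.green {z} 1 y + C := by
  obtain ⟨K, W, C, hC, hW, hdrift⟩ := hM.exists_lyapunov hirr hpos z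
  set D : Set (S × S) := {p | p.1 = p.2 ∨ R.Insulated p.1 p.2} with hD
  -- An insulated pair is already in `D`; any other pair coincides at some time with positive
  -- probability.
  obtain ⟨B, hB, hG⟩ := hM.pair.exists_green_finset_le (D := D) (K ×ˢ K) fun p _ => by
    by_cases hp : R.Insulated p.1 p.2
    · exact ⟨0, by simp [R.pair.killed_of_mem 1 0 (show p ∈ D from Or.inr hp)]⟩
    · obtain ⟨n, hn⟩ := not_forall.1 hp
      refine ⟨n, hM.pair.killed_one_lt fun h0 => hn ?_⟩
      exact measure_mono_null (fun ω hω => Or.inl hω) h0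
  set G := R.pair.green D (((K ×ˢ K : Finset (S × S)) : Set (S × S)).indicator 1) with hGdef
  refine ⟨C + C + 3 * B, by simp [ENNReal.add_lt_top, hC, ENNReal.mul_lt_top, hB],
    fun x y => ?_⟩
  rw [hM.lintegral_decisionTime]
  -- The term `3 * G p` offsets the positive drift `3 · 1_{K×K}`, leaving drift at most `-1` outside
  -- `D`.
  refine (R.pair.green_le (V := fun p => (W p.1 + W p.2) + 3 * G p) (fun p hp => ?_)
    (x, y)).trans ?_
  · rw [step_add, step_const_mul, pair_step_add, Pi.one_apply,
      show G p = _ from R.pair.green_eq _ hp]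
    have hind : (K : Set S).indicator (1 : S → ℝ≥0∞) p.1 + (K : Set S).indicator 1 p.2 ≤
        1 + ((K ×ˢ K : Finset (S × S)) : Set (S × S)).indicator 1 p := by
      by_cases h1 : p.1 ∈ K <;> by_cases h2 : p.2 ∈ K <;>
        simp [h1, h2]
    refine (ENNReal.add_le_add_iff_left (a := 3) (by norm_num)).1 ?_
    calc _ = (R.step W p.1 + 2) + (R.step W p.2 + 2) + 3 * R.pair.step G p := by ring
      _ ≤ (W p.1 + 3 * (K : Set S).indicator 1 p.1) +
          (W p.2 + 3 * (K : Set S).indicator 1 p.2) + 3 * R.pair.step G p := by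
        exact add_le_add_left (add_le_add (hdrift p.1) (hdrift p.2)) _
      _ = W p.1 + W p.2 + 3 * ((K : Set S).indicator 1 p.1 + (K : Set S).indicator 1 p.2) +
          3 * R.pair.step G p := by ring
      _ ≤ W p.1 + W p.2 +
          3 * (1 + ((K ×ˢ K : Finset (S × S)) : Set (S × S)).indicator 1 p) +
          3 * R.pair.step G p := by gcongr
      _ = _ := by ring
  · calc W x + W y + 3 * G (x, y)
        ≤ (2 * R.green {z} 1 x + C) + (2 * R.green {z} 1 y + C) + 3 * B := by
          gcongr
          · exact hW x
          · exact hW y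
          · exact hG (x, y)
      _ = _ := by ring

/-! ### Integrability of the hitting time under `π`. -/

/-- A stationary distribution integrates `H` if there is a finite function whose drift is at most
`-H`, up to a constant. -/
theorem IsStationary.tsum_mul_le {R : RDS μ S} {π : PMF S} (hπ : R.IsStationary π)
    {V H : S → ℝ≥0∞} {C : ℝ≥0∞} (hV : ∀ x, V x < ∞)
    (h : ∀ x, R.step V x + H x ≤ V x + C) : ∑' x, π x * H x ≤ C := by
  -- `V` need not be `π`-integrable, so its stationary mean cannot be cancelled directly; that of
  -- `min V L` can.
  have htrunc : ∀ L : ℕ, ∑' x, π x * {x | V x ≤ L}.indicator H x ≤ C := fun L => by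
    have hle : ∀ x, R.step (fun y => min (V y) L) x + {x | V x ≤ L}.indicator H x ≤
        min (V x) L + C := fun x => by
      by_cases hx : V x ≤ L
      · rw [Set.indicator_of_mem (show x ∈ {x | V x ≤ L} from hx), min_eq_left hx]
        exact (add_le_add_left (R.step_mono (fun y => min_le_left _ _) x) _).trans (h x)
      · rw [Set.indicator_of_notMem (show x ∉ {x | V x ≤ L} from hx), add_zero,
          min_eq_right (not_le.1 hx).le]
        exact ((R.step_mono (fun y => min_le_right _ _) x).trans_eq (R.step_const _ x)).trans
          le_self_add
    have hfin : ∑' x, π x * min (V x) L ≠ ∞ := by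
      refine ne_top_of_le_ne_top (b := (L : ℝ≥0∞)) (by simp) ?_
      calc ∑' x, π x * min (V x) L ≤ ∑' x, π x * L :=
            ENNReal.tsum_le_tsum fun x => by gcongr; exact min_le_right _ _
        _ = L := by rw [ENNReal.tsum_mul_right, π.tsum_coe, one_mul]
    refine (ENNReal.add_le_add_iff_left hfin).1 ?_
    calc _ = ∑' x, π x * (R.step (fun y => min (V y) L) x + {x | V x ≤ L}.indicator H x) := by
          simp only [mul_add]
          rw [ENNReal.tsum_add, hπ.tsum_step]
      _ ≤ ∑' x, π x * (min (V x) L + C) :=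
          ENNReal.tsum_le_tsum fun x => mul_le_mul_right (hle x) _
      _ = _ := by
          simp only [mul_add]
          rw [ENNReal.tsum_add, ENNReal.tsum_mul_right, π.tsum_coe, one_mul]
  rw [ENNReal.tsum_eq_iSup_sum]
  refine iSup_le fun s => ?_
  obtain ⟨L, hL⟩ : ∃ L : ℕ, ∀ x ∈ s, V x ≤ L := by
    obtain ⟨L, hL⟩ := ENNReal.exists_nat_gt (ENNReal.sum_lt_top.2 fun x (_ : x ∈ s) => hV x).ne
    exact ⟨L, fun x hx => (Finset.single_le_sum (fun _ _ => zero_le) hx).trans hL.le⟩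
  calc ∑ x ∈ s, π x * H x = ∑ x ∈ s, π x * {x | V x ≤ L}.indicator H x :=
        Finset.sum_congr rfl fun x hx => by
          rw [Set.indicator_of_mem (show x ∈ {x | V x ≤ L} from hL x hx)]
    _ ≤ ∑' x, π x * {x | V x ≤ L}.indicator H x := ENNReal.sum_le_tsum s
    _ ≤ C := htrunc L

theorem IsMarkov.tsum_mul_green_lt_top {R : RDS μ S} (hM : R.IsMarkov)
    (hirr : R.ChainIrreducible) {z : S}
    (hz : ∫⁻ ω, (returnTime (R.chain z ω) z : ℝ≥0∞) ^ 2 ∂μ < ∞) {π : PMF S}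
    (hπ : R.IsStationary π) : ∑' x, π x * R.green {z} 1 x < ∞ := by
  -- With `T` the hitting time of `z`, `V x = E_x[T (T + 1) / 2]`. Off `z` its drift is exactly
  -- `-H`; at `z`, where `V` and `H` vanish, the constant `R.step V z` is needed, and the second
  -- moment makes it finite.
  set V : S → ℝ≥0∞ := fun x => ∑' n : ℕ, ((n + 1 : ℕ) : ℝ≥0∞) * R.killed {z} 1 n x with hVdef
  have hstep : ∀ x, R.step V x = ∑' n : ℕ, ((n + 1 : ℕ) : ℝ≥0∞) * R.step (R.killed {z} 1 n) x :=
    fun x => by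
      rw [hVdef, step_tsum]
      simp only [step_const_mul]
  have hVz : R.step V z < ∞ := by
    rw [hstep]
    refine lt_of_le_of_lt (hM.tsum_mul_step_killed_le (fun n => n) z) (lt_of_le_of_lt ?_ hz)
    exact lintegral_mono fun ω => tsum_mul_coe_lt_le _
  have hVeq : ∀ x ≠ z, V x = R.step V x + R.green {z} 1 x := fun x hx => by
    rw [hstep, green, tsum_eq_zero_add' (f := fun n => R.killed {z} 1 n x) ENNReal.summable,
      hVdef]
    simp only []
    rw [tsum_eq_zero_add' (f := fun n : ℕ => ((n + 1 : ℕ) : ℝ≥0∞) * _) ENNReal.summable,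
      add_left_comm, ← ENNReal.tsum_add]
    congr 1
    · simp
    · refine tsum_congr fun n => ?_
      rw [R.killed_succ 1 n (D := {z}) hx]
      push_cast
      ring
  have hVfin : ∀ x, V x < ∞ := by
    refine hM.lt_top_of_step hirr (fun x hx => ?_) (x := z) (by simp [hVdef, R.killed_of_mem])
    by_cases hxz : x = z
    · exact hxz ▸ hVz
    · rw [hVeq x hxz] at hx
      exact lt_of_le_of_lt le_self_add hx
  refine lt_of_le_of_lt (hπ.tsum_mul_le hVfin (C := R.step V z) fun x => ?_) hVz
  by_cases hxz : x = z
  · subst hxz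
    simp [R.green_of_mem]
  · rw [← hVeq x hxz]
    exact le_self_add

end RDS

theorem proposition4p5 {Ω : Type*} [MeasurableSpace Ω] (μ : Measure Ω) [IsProbabilityMeasure μ]
    {S : Type*} [Countable S] [MeasurableSpace S] [DiscreteMeasurableSpace S]
    (R : RDS μ S) (hM : R.IsMarkov)
    (hirr : R.ChainIrreducible) (hpos : R.ChainPositiveRecurrent) :
    (∀ x y : S, ∫⁻ ω, (R.decisionTime ω x y : ℝ≥0∞) ∂μ < ∞) ∧
    (R.ChainErgodicDegreeTwo → ∀ π : PMF S, R.IsStationary π →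
      (∑' p : S × S, π p.1 * π p.2 * (∫⁻ ω, (R.decisionTime ω p.1 p.2 : ℝ≥0∞) ∂μ)) < ∞) := by
  refine ⟨fun x y => ?_, fun ⟨z, hz⟩ π hπ => ?_⟩
  · obtain ⟨C, hC, hle⟩ := hM.exists_lintegral_decisionTime_le hirr hpos x
    refine (hle x y).trans_lt ?_
    have hH := hM.green_one_lt_top hirr hpos x
    simp [ENNReal.add_lt_top, ENNReal.mul_lt_top, hH, hC]
  · obtain ⟨C, hC, hle⟩ := hM.exists_lintegral_decisionTime_le hirr hpos z
    have hH := hM.tsum_mul_green_lt_top hirr hz hπ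
    set H := R.green {z} 1 with hHdef
    calc ∑' p : S × S, π p.1 * π p.2 * (∫⁻ ω, (R.decisionTime ω p.1 p.2 : ℝ≥0∞) ∂μ)
        ≤ ∑' p : S × S, π p.1 * π p.2 * (2 * H p.1 + 2 * H p.2 + C) :=
          ENNReal.tsum_le_tsum fun p => by gcongr; exact hle p.1 p.2
      _ = ∑' (x : S) (y : S), (2 * (π x * H x) * π y + 2 * π x * (π y * H y) +
            C * π x * π y) := by
          rw [ENNReal.tsum_prod (f := fun x y => π x * π y * (2 * H x + 2 * H y + C))]
          exact tsum_congr fun x => tsum_congr fun y => by ring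
      _ = 2 * (∑' x, π x * H x) + 2 * (∑' x, π x * H x) + C := by
          simp only [ENNReal.tsum_add, ENNReal.tsum_mul_left, ENNReal.tsum_mul_right,
            π.tsum_coe, mul_one]
      _ < ∞ := by simp [ENNReal.add_lt_top, ENNReal.mul_lt_top, hH, hC]
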